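/- Let $X$ be a (real or complex, not necessarily Hausdorff) locally convex topological vector space, and let $C\subset X$ be a bounded convex set which is not totally bounded. Then there is a uniformly continuous map $f\colon C\to C$ which has no approximate fixed point net, i.e. there is no net $(x_i)_{i\in I}$ in $C$ such that $x_i-f(x_i)\to 0$. Here boundedness, total boundedness and uniform continuity refer to the linear topology of $X$ and the translation-invariant uniformity it induces: $C$ is bounded if it is absorbed by every neighbourhood of $0$, and totally bounded if for every neighbourhood $U$ of $0$ it is covered by finitely many translates of $U$. -/

import Mathlib

open Filter Topology

universe u

/-- A self-map `f` of a subset `C` of a topological additive group `X` has an approximate fixed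
point net: there is a net `(x i)` in `C`, indexed by a nonempty directed preorder, with
`x i - f (x i) → 0`. (Restricting the index set to the universe of `X` loses nothing, see
`hasApproxFixedPointNet_of_net`.) -/
def HasApproxFixedPointNet {X : Type u} [AddCommGroup X] [TopologicalSpace X] {C : Set X}
    (f : C → C) : Prop :=
  ∃ (ι : Type u) (_ : Preorder ι) (_ : IsDirectedOrder ι) (_ : Nonempty ι) (x : ι → C),
    Tendsto (fun i => (x i : X) - (f (x i) : X)) atTop (𝓝 0)

theorem hasApproxFixedPointNet_iff {X : Type u} [AddCommGroup X] [TopologicalSpace X] {C : Set X}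
    (f : C → C) :
    HasApproxFixedPointNet f ↔ (0 : X) ∈ closure (Set.range fun x : C => (x : X) - (f x : X)) := by
  constructor
  · rintro ⟨ι, _, _, _, x, hx⟩
    exact mem_closure_of_tendsto hx (Eventually.of_forall fun i => ⟨x i, rfl⟩)
  · intro h
    have key : ∀ U : {U : Set X // U ∈ 𝓝 (0 : X)}, ∃ x : C, (x : X) - (f x : X) ∈ U.1 := by
      rintro ⟨U, hU⟩
      obtain ⟨_, hy, x, rfl⟩ := mem_closure_iff_nhds.1 h U hU
      exact ⟨x, hy⟩
    choose x hx using key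
    refine ⟨{U : Set X // U ∈ 𝓝 (0 : X)}ᵒᵈ, inferInstance, ⟨fun U V => ?_⟩,
      ⟨OrderDual.toDual ⟨Set.univ, univ_mem⟩⟩, fun U => x (OrderDual.ofDual U), ?_⟩
    · exact ⟨OrderDual.toDual ⟨(OrderDual.ofDual U).1 ∩ (OrderDual.ofDual V).1,
        inter_mem (OrderDual.ofDual U).2 (OrderDual.ofDual V).2⟩,
        Set.inter_subset_left, Set.inter_subset_right⟩
    · intro U hU
      rw [mem_map]
      refine mem_of_superset (Ici_mem_atTop
        (OrderDual.toDual (⟨U, hU⟩ : {U : Set X // U ∈ 𝓝 (0 : X)}))) fun V hV => ?_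
      exact (show (OrderDual.ofDual V).1 ⊆ U from hV) (hx _)

/-- A net indexed in an arbitrary universe yields one as in `HasApproxFixedPointNet`. -/
theorem hasApproxFixedPointNet_of_net {X : Type u} [AddCommGroup X] [TopologicalSpace X]
    {C : Set X} (f : C → C) {ι : Type*} [Preorder ι] [IsDirectedOrder ι] [Nonempty ι] (x : ι → C)
    (hx : Tendsto (fun i => (x i : X) - (f (x i) : X)) atTop (𝓝 0)) :
    HasApproxFixedPointNet f :=
  (hasApproxFixedPointNet_iff f).2
    (mem_closure_of_tendsto hx (Eventually.of_forall fun i => ⟨x i, rfl⟩))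

/-!
Some continuous seminorm sees that `C` is not totally bounded, and for it `C` contains a sequence
whose terms are uniformly far from the span of their predecessors. Measure the distances of a point
`y` to these increasing spans, rescaled and truncated at `1`: this is the profile of `y`. On the
broken line through the sequence the profile drops from `1` to `0` within two steps, and the place
of the drop tells the parameter up to a bounded error. The map `f` sends `y` to a point that depends
only on its profile. If the profile drops very sharply, `f y` lies on the broken line ahead of the
drop; as the drop becomes blunter, `f y` falls back along the line until it is behind the drop, and
it is then contracted to the first term of the sequence, where points with blunt profiles go. In
each case `y` and `f y` have profiles that differ by a definite amount, so they are apart. The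
profile is Lipschitz for the one seminorm chosen, and boundedness of `C` turns this into uniform
continuity of `f` for all the others.
-/

section Profiles

/-- The numbers `B n` record how far a point is from the `n`-th term of an increasing sequence of
subspaces, truncated and rescaled to the unit interval. -/
structure IsProfile (B : ℕ → ℝ) : Prop where
  antitone : Antitone B
  nonneg : ∀ n, 0 ≤ B n
  le_one : ∀ n, B n ≤ 1

/-- The retraction of the real line onto the unit interval, as a real number. -/
noncomputable def unitClamp (a : ℝ) : ℝ := Set.projIcc 0 1 zero_le_one a

/-- The largest drop of the sequence `B` within two steps. Profiles with sharpness near `1` are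
those of the points near the broken line along which the final map pushes. -/
noncomputable def sharpness (B : ℕ → ℝ) : ℝ := ⨆ n, (B n - B (n + 2))

/-- A continuous version of the number of large terms of `B`; it locates the drop of a sufficiently
sharp profile, and only then is the series known to have finitely many nonzero terms. -/
noncomputable def position (B : ℕ → ℝ) : ℝ := ∑' n, unitClamp (3 * B n - 1)

variable {B B' : ℕ → ℝ} {η : ℝ}

theorem unitClamp_nonneg (a : ℝ) : 0 ≤ unitClamp a := (Set.projIcc 0 1 _ a).2.1

theorem unitClamp_le_one (a : ℝ) : unitClamp a ≤ 1 := (Set.projIcc 0 1 _ a).2.2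

theorem unitClamp_of_nonpos {a : ℝ} (ha : a ≤ 0) : unitClamp a = 0 :=
  congrArg Subtype.val (Set.projIcc_of_le_left _ ha)

theorem unitClamp_of_one_le {a : ℝ} (ha : 1 ≤ a) : unitClamp a = 1 :=
  congrArg Subtype.val (Set.projIcc_of_right_le _ ha)

theorem abs_unitClamp_sub_le (a b : ℝ) : |unitClamp a - unitClamp b| ≤ |a - b| :=
  Set.abs_projIcc_sub_projIcc _

theorem IsProfile.drop_le_one (hB : IsProfile B) (n : ℕ) : B n - B (n + 2) ≤ 1 := by
  linarith [hB.le_one n, hB.nonneg (n + 2)]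

theorem IsProfile.drop_le_sharpness (hB : IsProfile B) (n : ℕ) : B n - B (n + 2) ≤ sharpness B :=
  le_ciSup (f := fun n => B n - B (n + 2)) ⟨1, Set.forall_mem_range.2 hB.drop_le_one⟩ n

theorem IsProfile.sharpness_le_one (hB : IsProfile B) : sharpness B ≤ 1 :=
  ciSup_le hB.drop_le_one

theorem IsProfile.sharpness_eq_one (hB : IsProfile B) {m : ℕ} (h1 : B m = 1) (h0 : B (m + 2) = 0) :
    sharpness B = 1 :=
  hB.sharpness_le_one.antisymm (by simpa [h1, h0] using hB.drop_le_sharpness m)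

theorem IsProfile.abs_sharpness_sub_le (hB : IsProfile B) (hB' : IsProfile B')
    (hη : ∀ n, |B n - B' n| ≤ η) : |sharpness B - sharpness B'| ≤ 2 * η := by
  refine abs_sub_le_iff.2 ⟨sub_le_iff_le_add.2 (ciSup_le fun n => ?_),
    sub_le_iff_le_add.2 (ciSup_le fun n => ?_)⟩
  · linarith [abs_le.1 (hη n), abs_le.1 (hη (n + 2)), hB'.drop_le_sharpness n]
  · linarith [abs_le.1 (hη n), abs_le.1 (hη (n + 2)), hB.drop_le_sharpness n]

theorem IsProfile.exists_drop (hB : IsProfile B) {s : ℝ} (hs : s < sharpness B) :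
    ∃ m, s < B m ∧ B (m + 2) < 1 - s := by
  obtain ⟨m, hm⟩ := exists_lt_of_lt_ciSup hs
  exact ⟨m, by linarith [hB.nonneg (m + 2)], by linarith [hB.le_one m]⟩

theorem position_eq (hB : Antitone B) {m : ℕ} (hm : 2 / 3 ≤ B m) (hm' : B (m + 2) ≤ 1 / 3) :
    position B = m + 1 + unitClamp (3 * B (m + 1) - 1) := by
  have hlarge : ∀ n ∈ Finset.range (m + 1), unitClamp (3 * B n - 1) = 1 := fun n hn =>
    unitClamp_of_one_le (by linarith [hB (Nat.lt_succ_iff.1 (Finset.mem_range.1 hn))])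
  have hsmall : ∀ n ∉ Finset.range (m + 2), unitClamp (3 * B n - 1) = 0 := fun n hn =>
    unitClamp_of_nonpos (by linarith [hB (not_lt.1 (mt Finset.mem_range.2 hn))])
  rw [position, tsum_eq_sum hsmall, Finset.sum_range_succ, Finset.sum_congr rfl hlarge]
  simp

theorem IsProfile.abs_position_sub_le (hB : IsProfile B) (hB' : IsProfile B')
    (hs : 3 / 4 < sharpness B) (hη : ∀ n, |B n - B' n| ≤ η) (hη' : η ≤ 1 / 12) :
    |position B - position B'| ≤ 3 * η := by
  obtain ⟨m, hm, hm'⟩ := hB.exists_drop hs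
  rw [position_eq hB.antitone (m := m) (by linarith) (by linarith),
    position_eq hB'.antitone (m := m) (by linarith [abs_le.1 (hη m)])
      (by linarith [abs_le.1 (hη (m + 2))]), add_sub_add_left_eq_sub]
  refine (abs_unitClamp_sub_le _ _).trans ?_
  rw [sub_sub_sub_cancel_right, ← mul_sub, abs_mul, abs_of_pos three_pos]
  exact mul_le_mul_of_nonneg_left (hη _) zero_le_three

theorem IsProfile.le_position (hB : IsProfile B) (hs : 2 / 3 < sharpness B) {k : ℕ}
    (hk : B k = 1) : k ≤ position B := by
  obtain ⟨m, hm, hm'⟩ := hB.exists_drop hs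
  have hkm : k < m + 2 := by
    by_contra! h
    linarith [hB.antitone h]
  rw [position_eq hB.antitone hm.le (by linarith)]
  have : (k : ℝ) ≤ m + 1 := by exact_mod_cast Nat.lt_succ_iff.1 hkm
  linarith [unitClamp_nonneg (3 * B (m + 1) - 1)]

theorem IsProfile.position_le (hB : IsProfile B) (hs : 2 / 3 < sharpness B) {k : ℕ}
    (hk : B k = 0) : position B ≤ k + 1 := by
  obtain ⟨m, hm, hm'⟩ := hB.exists_drop hs
  have hmk : m < k := by
    by_contra! h
    linarith [hB.antitone h]
  rw [position_eq hB.antitone hm.le (by linarith)]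
  have : (m : ℝ) + 1 ≤ k := by exact_mod_cast hmk
  linarith [unitClamp_le_one (3 * B (m + 1) - 1)]

/-- The parameter on the broken line towards which a point with profile `B` is sent: two units ahead
of its position if `B` is perfectly sharp, and four units behind it if `sharpness B = 7 / 8`. -/
noncomputable def targetTime (B : ℕ → ℝ) : ℝ := max 0 (position B + 2 - 48 * (1 - sharpness B))

/-- The weight with which the target on the broken line counts, against the initial point: it is
zero for the blunt profiles, whose position carries no information. -/
noncomputable def targetWeight (B : ℕ → ℝ) : ℝ := unitClamp (8 * sharpness B - 6)

theorem targetTime_nonneg (B : ℕ → ℝ) : 0 ≤ targetTime B := le_max_left _ _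

theorem targetWeight_eq_zero (hs : sharpness B ≤ 3 / 4) : targetWeight B = 0 :=
  unitClamp_of_nonpos (by linarith)

theorem targetWeight_eq_one (hs : 7 / 8 ≤ sharpness B) : targetWeight B = 1 :=
  unitClamp_of_one_le (by linarith)

theorem targetWeight_mem_Icc (B : ℕ → ℝ) : targetWeight B ∈ Set.Icc (0 : ℝ) 1 :=
  ⟨unitClamp_nonneg _, unitClamp_le_one _⟩

theorem IsProfile.abs_targetTime_sub_le (hB : IsProfile B) (hB' : IsProfile B')
    (hs : 3 / 4 < sharpness B) (hη : ∀ n, |B n - B' n| ≤ η) (hη' : η ≤ 1 / 12) :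
    |targetTime B - targetTime B'| ≤ 99 * η := by
  have hpos := abs_le.1 (hB.abs_position_sub_le hB' hs hη hη')
  have hsharp := abs_le.1 (hB.abs_sharpness_sub_le hB' hη)
  refine (abs_max_sub_max_le_max _ _ _ _).trans (max_le ?_ (abs_le.2 ⟨by linarith, by linarith⟩))
  rw [sub_self, abs_zero]
  linarith

theorem IsProfile.abs_targetWeight_sub_le (hB : IsProfile B) (hB' : IsProfile B')
    (hη : ∀ n, |B n - B' n| ≤ η) : |targetWeight B - targetWeight B'| ≤ 16 * η := by
  refine (abs_unitClamp_sub_le _ _).trans ?_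
  rw [sub_sub_sub_cancel_right, ← mul_sub, abs_mul, abs_of_pos (by norm_num)]
  linarith [hB.abs_sharpness_sub_le hB' hη]

-- If `B` and `B'` were close, then `B` would be nearly perfectly sharp, and the target time would
-- be ahead of the positions of both.
theorem IsProfile.exists_lt_abs_sub_of_drop_targetTime (hB : IsProfile B) (hB' : IsProfile B')
    (h1 : B' ⌊targetTime B⌋₊ = 1) (h0 : B' (⌊targetTime B⌋₊ + 2) = 0) :
    ∃ n, 1 / 100 < |B n - B' n| := by
  by_contra! hη
  have hs' : sharpness B' = 1 := hB'.sharpness_eq_one h1 h0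
  have hsharp := abs_le.1 (hB.abs_sharpness_sub_le hB' hη)
  have hpos := abs_le.1 (hB.abs_position_sub_le hB' (by linarith) hη (by norm_num))
  have hfloor : ⌊targetTime B⌋₊ ≤ position B' := hB'.le_position (by linarith) h1
  have htime : position B + 2 - 48 * (1 - sharpness B) ≤ targetTime B := le_max_right _ _
  linarith [Nat.lt_floor_add_one (targetTime B)]

-- Here the target time is behind the position of `B`, and `B'` has dropped to zero by then.
theorem IsProfile.exists_lt_abs_sub_of_targetTime_pos (hB : IsProfile B) (hB' : IsProfile B')
    (hs : 3 / 4 < sharpness B) (hs' : sharpness B ≤ 7 / 8) (htime : 0 < targetTime B)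
    (h0 : B' (⌊targetTime B⌋₊ + 2) = 0) : ∃ n, 1 / 100 < |B n - B' n| := by
  by_contra! hη
  have hsharp := abs_le.1 (hB.abs_sharpness_sub_le hB' hη)
  have hpos := abs_le.1 (hB.abs_position_sub_le hB' hs hη (by norm_num))
  have hfloor := hB'.position_le (by linarith) h0
  push_cast at hfloor
  have htime' : targetTime B ≤ position B - 4 :=
    max_le (by rcases lt_max_iff.1 htime with h | h <;> linarith) (by linarith)
  linarith [Nat.floor_le (targetTime_nonneg B)]

end Profiles

section BrokenLine

/-- The broken line with vertices `x n` at the integer times `n`; only times `v ≥ 0` are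
meaningful. -/
noncomputable def brokenLine {X : Type*} [AddCommGroup X] [Module ℝ X] (x : ℕ → X) (v : ℝ) : X :=
  AffineMap.lineMap (x ⌊v⌋₊) (x (⌊v⌋₊ + 1)) (v - ⌊v⌋₊)

/-- The image of a point with profile `B` under the map without approximate fixed points. -/
noncomputable def target {X : Type*} [AddCommGroup X] [Module ℝ X] (x : ℕ → X) (B : ℕ → ℝ) : X :=
  AffineMap.lineMap (x 0) (brokenLine x (targetTime B)) (targetWeight B)

/-- The span of the terms of the sequence `x` of index less than `n`. -/
def spanBelow {X : Type*} [AddCommGroup X] [Module ℝ X] (x : ℕ → X) (n : ℕ) :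
    Submodule ℝ X :=
  Submodule.span ℝ (x '' Set.Iio n)

variable {X : Type*} [AddCommGroup X] [Module ℝ X] {x : ℕ → X} {C : Set X}

theorem brokenLine_zero (x : ℕ → X) : brokenLine x 0 = x 0 := by
  simp [brokenLine]

theorem brokenLine_eq_lineMap (x : ℕ → X) {n : ℕ} {v : ℝ} (hn : n ≤ v) (hn' : v ≤ n + 1) :
    brokenLine x v = AffineMap.lineMap (x n) (x (n + 1)) (v - n) := by
  rcases hn'.lt_or_eq with hlt | rfl
  · rw [brokenLine, (Nat.floor_eq_iff ((Nat.cast_nonneg n).trans hn)).2 ⟨hn, hlt⟩]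
  · have hfloor : ⌊(n : ℝ) + 1⌋₊ = n + 1 := by exact_mod_cast Nat.floor_natCast (n + 1)
    simp [brokenLine, hfloor]

theorem brokenLine_mem (hC : Convex ℝ C) (hx : ∀ n, x n ∈ C) {v : ℝ} (hv : 0 ≤ v) :
    brokenLine x v ∈ C :=
  hC.lineMap_mem (hx _) (hx _)
    ⟨sub_nonneg.2 (Nat.floor_le hv), by linarith [Nat.lt_floor_add_one v]⟩

theorem seminorm_brokenLine_sub_eq (q : Seminorm ℝ X) (x : ℕ → X) {n : ℕ} {v w : ℝ}
    (hv : n ≤ v) (hvw : v ≤ w) (hw : w ≤ n + 1) :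
    q (brokenLine x w - brokenLine x v) = (w - v) * q (x (n + 1) - x n) := by
  rw [brokenLine_eq_lineMap x hv (hvw.trans hw), brokenLine_eq_lineMap x (hv.trans hvw) hw,
    AffineMap.lineMap_apply_module', AffineMap.lineMap_apply_module', add_sub_add_right_eq_sub,
    ← sub_smul, sub_sub_sub_cancel_right, map_smul_eq_mul, Real.norm_of_nonneg (sub_nonneg.2 hvw)]

theorem seminorm_brokenLine_sub_le_of_le (q : Seminorm ℝ X) (hC : Convex ℝ C) (hx : ∀ n, x n ∈ C)
    {D : ℝ} (hD : ∀ y ∈ C, ∀ z ∈ C, q (y - z) ≤ D) {v w : ℝ} (hv : 0 ≤ v) (hvw : v ≤ w) :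
    q (brokenLine x w - brokenLine x v) ≤ (w - v) * D := by
  have hsegment : ∀ {n : ℕ} {v w : ℝ}, n ≤ v → v ≤ w → w ≤ n + 1 →
      q (brokenLine x w - brokenLine x v) ≤ (w - v) * D := fun hv hvw hw =>
    (seminorm_brokenLine_sub_eq q x hv hvw hw).trans_le
      (mul_le_mul_of_nonneg_left (hD _ (hx _) _ (hx _)) (sub_nonneg.2 hvw))
  have hfloor : ⌊v⌋₊ ≤ v := Nat.floor_le hv
  have hfloor' : v < ⌊v⌋₊ + 1 := Nat.lt_floor_add_one v
  rcases le_or_gt w (⌊v⌋₊ + 1) with hw | hw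
  · exact hsegment hfloor hvw hw
  rcases le_or_gt 1 (w - v) with hfar | hnear
  · have hD0 : 0 ≤ D := (apply_nonneg q _).trans (hD _ (hx 0) _ (hx 0))
    exact (hD _ (brokenLine_mem hC hx (hv.trans hvw)) _ (brokenLine_mem hC hx hv)).trans
      (le_mul_of_one_le_left hD0 hfar)
  · have hleft := hsegment hfloor hfloor'.le le_rfl
    have hright : q (brokenLine x w - brokenLine x (⌊v⌋₊ + 1)) ≤ (w - (⌊v⌋₊ + 1)) * D :=
      hsegment (n := ⌊v⌋₊ + 1) (by push_cast; exact le_rfl) hw.le (by push_cast; linarith)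
    have htri := map_add_le_add q (brokenLine x w - brokenLine x (⌊v⌋₊ + 1))
      (brokenLine x (⌊v⌋₊ + 1) - brokenLine x v)
    rw [sub_add_sub_cancel] at htri
    linarith

theorem seminorm_brokenLine_sub_le (q : Seminorm ℝ X) (hC : Convex ℝ C) (hx : ∀ n, x n ∈ C)
    {D : ℝ} (hD : ∀ y ∈ C, ∀ z ∈ C, q (y - z) ≤ D) {v w : ℝ} (hv : 0 ≤ v) (hw : 0 ≤ w) :
    q (brokenLine x v - brokenLine x w) ≤ |v - w| * D := by
  rcases le_total v w with hvw | hwv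
  · rw [map_sub_rev, abs_sub_comm, abs_of_nonneg (sub_nonneg.2 hvw)]
    exact seminorm_brokenLine_sub_le_of_le q hC hx hD hv hvw
  · rw [abs_of_nonneg (sub_nonneg.2 hwv)]
    exact seminorm_brokenLine_sub_le_of_le q hC hx hD hw hwv

theorem target_mem (hC : Convex ℝ C) (hx : ∀ n, x n ∈ C) (B : ℕ → ℝ) : target x B ∈ C :=
  hC.lineMap_mem (hx 0) (brokenLine_mem hC hx (targetTime_nonneg B)) (targetWeight_mem_Icc B)

theorem target_eq_apply_zero (x : ℕ → X) {B : ℕ → ℝ} (hs : sharpness B ≤ 3 / 4) :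
    target x B = x 0 := by
  rw [target, targetWeight_eq_zero hs, AffineMap.lineMap_apply_zero]

theorem target_eq_brokenLine (x : ℕ → X) {B : ℕ → ℝ} (hs : 7 / 8 ≤ sharpness B) :
    target x B = brokenLine x (targetTime B) := by
  rw [target, targetWeight_eq_one hs, AffineMap.lineMap_apply_one]

theorem IsProfile.seminorm_target_sub_le (q : Seminorm ℝ X) (hC : Convex ℝ C)
    (hx : ∀ n, x n ∈ C) {D : ℝ} (hD : ∀ y ∈ C, ∀ z ∈ C, q (y - z) ≤ D) {B B' : ℕ → ℝ}
    (hB : IsProfile B) (hB' : IsProfile B') {η : ℝ} (hη : ∀ n, |B n - B' n| ≤ η)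
    (hη' : η ≤ 1 / 12) : q (target x B - target x B') ≤ 115 * η * D := by
  have hD0 : 0 ≤ D := (apply_nonneg q _).trans (hD _ (hx 0) _ (hx 0))
  have hη0 : 0 ≤ η := (abs_nonneg _).trans (hη 0)
  set a := brokenLine x (targetTime B) with ha
  set a' := brokenLine x (targetTime B') with ha'
  have hsplit : target x B - target x B' =
      (targetWeight B - targetWeight B') • (a' - x 0) + targetWeight B • (a - a') := by
    simp only [target, AffineMap.lineMap_apply_module', ← ha, ← ha']
    module
  have hweight : q ((targetWeight B - targetWeight B') • (a' - x 0)) ≤ 16 * η * D := by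
    rw [map_smul_eq_mul, Real.norm_eq_abs]
    exact mul_le_mul (hB.abs_targetWeight_sub_le hB' hη)
      (hD _ (brokenLine_mem hC hx (targetTime_nonneg B')) _ (hx 0)) (apply_nonneg q _)
      (by positivity)
  have htime : q (targetWeight B • (a - a')) ≤ 99 * η * D := by
    rcases le_or_gt (sharpness B) (3 / 4) with hs | hs
    · rw [targetWeight_eq_zero hs, zero_smul, map_zero]
      positivity
    obtain ⟨hw0, hw1⟩ := targetWeight_mem_Icc B
    rw [map_smul_eq_mul, Real.norm_of_nonneg hw0]
    calc targetWeight B * q (a - a') ≤ q (a - a') := mul_le_of_le_one_left (apply_nonneg q _) hw1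
      _ ≤ |targetTime B - targetTime B'| * D :=
        seminorm_brokenLine_sub_le q hC hx hD (targetTime_nonneg B) (targetTime_nonneg B')
      _ ≤ 99 * η * D :=
        mul_le_mul_of_nonneg_right (hB.abs_targetTime_sub_le hB' hs hη hη') hD0
  calc q (target x B - target x B') ≤ 16 * η * D + 99 * η * D :=
        hsplit ▸ (map_add_le_add q _ _).trans (add_le_add hweight htime)
    _ = 115 * η * D := by ring

theorem spanBelow_mono (x : ℕ → X) : Monotone (spanBelow x) := fun _ _ h =>
  Submodule.span_mono (Set.image_mono (Set.Iio_subset_Iio h))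

theorem mem_spanBelow {m n : ℕ} (h : m < n) : x m ∈ spanBelow x n :=
  Submodule.subset_span (Set.mem_image_of_mem x h)

theorem brokenLine_mem_spanBelow (x : ℕ → X) (v : ℝ) : brokenLine x v ∈ spanBelow x (⌊v⌋₊ + 2) :=
  AffineMap.lineMap_mem _ (Q := (spanBelow x _).toAffineSubspace) (mem_spanBelow (by lia))
    (mem_spanBelow (by lia))

theorem target_mem_spanBelow (x : ℕ → X) (B : ℕ → ℝ) :
    target x B ∈ spanBelow x (⌊targetTime B⌋₊ + 2) :=
  AffineMap.lineMap_mem _ (Q := (spanBelow x _).toAffineSubspace) (mem_spanBelow (by lia))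
    (brokenLine_mem_spanBelow x _)

end BrokenLine

section FarSequence

variable (𝕜 : Type*) [NontriviallyNormedField 𝕜] [LocallyCompactSpace 𝕜]

theorem totallyBounded_of_isBounded_of_finiteDimensional {E : Type*} [SeminormedAddCommGroup E]
    [NormedSpace 𝕜 E] [FiniteDimensional 𝕜 E] {s : Set E} (hs : Bornology.IsBounded s) :
    TotallyBounded s := by
  have : FiniteDimensional 𝕜 (SeparationQuotient E) :=
    Module.Finite.of_surjective (SeparationQuotient.mkCLM 𝕜 E).toLinearMap
      SeparationQuotient.surjective_mk
  have : ProperSpace (SeparationQuotient E) := FiniteDimensional.proper 𝕜 _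
  obtain ⟨r, hr⟩ := hs.subset_closedBall 0
  refine (totallyBounded_preimage SeparationQuotient.isUniformInducing_mk
    (isCompact_closedBall (0 : SeparationQuotient E) r).totallyBounded).subset fun y hy => ?_
  simpa using hr hy

theorem totallyBounded_of_forall_exists_infDist_lt {V : Type*} [SeminormedAddCommGroup V]
    [NormedSpace 𝕜 V] {C : Set V} (hC : Bornology.IsBounded C)
    (h : ∀ δ > 0, ∃ E : Submodule 𝕜 V, FiniteDimensional 𝕜 E ∧ ∀ x ∈ C, Metric.infDist x E < δ) :
    TotallyBounded C := by
  rw [Metric.totallyBounded_iff]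
  intro ε hε
  obtain ⟨E, hE, hCE⟩ := h (ε / 2) (half_pos hε)
  have hnear : TotallyBounded (E ∩ Metric.thickening (ε / 2) C : Set V) := by
    have hbdd : Bornology.IsBounded ((↑) ⁻¹' Metric.thickening (ε / 2) C : Set E) :=
      E.subtypeₗᵢ.antilipschitz.isBounded_preimage hC.thickening
    exact Subtype.image_preimage_coe (E : Set V) _ ▸
      (totallyBounded_of_isBounded_of_finiteDimensional 𝕜 hbdd).image uniformContinuous_subtype_val
  obtain ⟨t, ht, hcover⟩ := Metric.totallyBounded_iff.1 hnear (ε / 2) (half_pos hε)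
  refine ⟨t, ht, fun x hx => ?_⟩
  obtain ⟨y, hyE, hxy⟩ := (Metric.infDist_lt_iff E.nonempty).1 (hCE x hx)
  obtain ⟨z, hz, hyz⟩ := Set.mem_iUnion₂.1
    (hcover ⟨hyE, Metric.mem_thickening_iff.2 ⟨x, hx, dist_comm x y ▸ hxy⟩⟩)
  exact Set.mem_iUnion₂.2 ⟨z, hz, (dist_triangle x y z).trans_lt
    (by linarith [Metric.mem_ball.1 hyz])⟩

theorem exists_seq_of_forall_exists_finset {α : Type*} [DecidableEq α] {P : Finset α → α → Prop}
    (h : ∀ s, ∃ a, P s a) : ∃ x : ℕ → α, ∀ n, P ((Finset.range n).image x) (x n) := by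
  choose g hg using h
  let S : ℕ → Finset α := Nat.rec ∅ fun _ s => insert (g s) s
  have hS : ∀ n, (Finset.range n).image (fun k => g (S k)) = S n := fun n => by
    induction n with
    | zero => rfl
    | succ n ih => rw [Finset.range_add_one, Finset.image_insert, ih]
  exact ⟨fun n => g (S n), fun n => hS n ▸ hg (S n)⟩

theorem exists_seq_le_infDist_spanBelow {V : Type*} [SeminormedAddCommGroup V] [NormedSpace ℝ V]
    {C : Set V} (hC : Bornology.IsBounded C) (hC' : ¬ TotallyBounded C) :
    ∃ δ > 0, ∃ x : ℕ → V, ∀ n, x n ∈ C ∧ δ ≤ Metric.infDist (x n) (spanBelow x n) := by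
  classical
  obtain ⟨δ, hδ, hfar⟩ : ∃ δ > 0, ∀ E : Submodule ℝ V, FiniteDimensional ℝ E →
      ∃ x ∈ C, δ ≤ Metric.infDist x E := by
    by_contra! h
    exact hC' (totallyBounded_of_forall_exists_infDist_lt ℝ hC h)
  have hspan : ∀ s : Finset V, ∃ x ∈ C, δ ≤ Metric.infDist x (Submodule.span ℝ (s : Set V)) :=
    fun s => hfar _ inferInstance
  obtain ⟨x, hx⟩ := exists_seq_of_forall_exists_finset hspan
  refine ⟨δ, hδ, x, fun n => ?_⟩
  simpa only [spanBelow, Finset.coe_image, Finset.coe_range] using hx n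

end FarSequence

section Profile

variable {V : Type*} [SeminormedAddCommGroup V] [NormedSpace ℝ V] {x : ℕ → V} {c δ M : ℝ}

/-- The distances from `y` to the subspaces `spanBelow x n`, in units of `c` and truncated at
`1`. -/
noncomputable def profile (x : ℕ → V) (c : ℝ) (y : V) (n : ℕ) : ℝ :=
  min 1 (Metric.infDist y (spanBelow x n) / c)

theorem isProfile_profile (x : ℕ → V) (hc : 0 < c) (y : V) : IsProfile (profile x c y) where
  antitone _ _ h := min_le_min_left 1 (div_le_div_of_nonneg_right
    (Metric.infDist_le_infDist_of_subset (spanBelow_mono x h) (spanBelow x _).nonempty) hc.le)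
  nonneg _ := le_min zero_le_one (div_nonneg Metric.infDist_nonneg hc.le)
  le_one _ := min_le_left _ _

theorem abs_profile_sub_le (x : ℕ → V) (hc : 0 < c) (y z : V) (n : ℕ) :
    |profile x c y n - profile x c z n| ≤ ‖y - z‖ / c := by
  have hdist : |Metric.infDist y (spanBelow x n) - Metric.infDist z (spanBelow x n)| ≤ ‖y - z‖ := by
    have h := (Metric.lipschitz_infDist_pt (spanBelow x n : Set V)).dist_le_mul y z
    rwa [NNReal.coe_one, one_mul, Real.dist_eq, dist_eq_norm] at h
  calc |profile x c y n - profile x c z n|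
      ≤ |Metric.infDist y (spanBelow x n) / c - Metric.infDist z (spanBelow x n) / c| := by
        simpa [profile] using abs_min_sub_min_le_max 1 (Metric.infDist y (spanBelow x n) / c) 1
          (Metric.infDist z (spanBelow x n) / c)
    _ ≤ ‖y - z‖ / c := by
        rw [← sub_div, abs_div, abs_of_pos hc]
        exact div_le_div_of_nonneg_right hdist hc.le

theorem profile_eq_zero {y : V} {n : ℕ} (hy : y ∈ spanBelow x n) : profile x c y n = 0 := by
  rw [profile, Metric.infDist_zero_of_mem hy, zero_div, min_eq_right zero_le_one]

theorem profile_eq_one (hc : 0 < c) {y : V} {n : ℕ} (hy : c ≤ Metric.infDist y (spanBelow x n)) :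
    profile x c y n = 1 :=
  min_eq_left ((one_le_div hc).2 hy)

theorem div_hundred_le_norm_sub_target (hc : 0 < c)
    (hline : ∀ v, 0 ≤ v → c ≤ Metric.infDist (brokenLine x v) (spanBelow x ⌊v⌋₊)) (y : V) :
    c / 100 ≤ ‖y - target x (profile x c y)‖ := by
  set B := profile x c y
  set z := target x B with hz
  suffices h : ∃ n, 1 / 100 < |B n - profile x c z n| by
    obtain ⟨n, hn⟩ := h
    have := hn.trans_le (abs_profile_sub_le x hc y z n)
    rw [lt_div_iff₀ hc] at this
    linarith
  have hB : IsProfile B := isProfile_profile x hc y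
  have hB' : IsProfile (profile x c z) := isProfile_profile x hc z
  have hdrop : ∀ {v}, 0 ≤ v → z = brokenLine x v →
      profile x c z ⌊v⌋₊ = 1 ∧ profile x c z (⌊v⌋₊ + 2) = 0 := by
    intro v hv hzv
    rw [hzv]
    exact ⟨profile_eq_one hc (hline v hv), profile_eq_zero (brokenLine_mem_spanBelow x v)⟩
  rcases le_or_gt (7 / 8) (sharpness B) with hsharp | hs
  · obtain ⟨h1, h0⟩ := hdrop (targetTime_nonneg B) (target_eq_brokenLine x hsharp)
    exact hB.exists_lt_abs_sub_of_drop_targetTime hB' h1 h0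
  by_cases hx0 : z = x 0
  · by_contra! hη
    obtain ⟨h1, h0⟩ := hdrop le_rfl (hx0.trans (brokenLine_zero x).symm)
    linarith [abs_le.1 (hB.abs_sharpness_sub_le hB' hη), hB'.sharpness_eq_one h1 h0]
  have hs' : 3 / 4 < sharpness B := not_le.1 fun h => hx0 (target_eq_apply_zero x h)
  have htime : 0 < targetTime B := (targetTime_nonneg B).lt_of_ne' fun h =>
    hx0 (by rw [hz, target, h, brokenLine_zero, AffineMap.lineMap_same_apply])
  exact hB.exists_lt_abs_sub_of_targetTime_pos hB' hs' hs.le htime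
    (profile_eq_zero (target_mem_spanBelow x B))

theorem infDist_eq_norm_mkQ (E : Submodule ℝ V) (y : V) : Metric.infDist y E = ‖E.mkQ y‖ :=
  (QuotientAddGroup.norm_mk (S := E.toAddSubgroup) y).symm

-- For small `t` the summand `(1 - t) • y` keeps the point away from `E`, for large `t` the summand
-- `t • z` keeps it away even from `F`.
theorem sq_div_le_infDist_lineMap {E F : Submodule ℝ V} (hEF : E ≤ F) {y z : V} (hyF : y ∈ F)
    (hδ : 0 < δ) (hy : δ ≤ Metric.infDist y E) (hz : δ ≤ Metric.infDist z F) (hM : ‖z‖ ≤ M)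
    {t : ℝ} (ht : t ∈ Set.Icc (0 : ℝ) 1) :
    δ ^ 2 / (2 * δ + M) ≤ Metric.infDist (AffineMap.lineMap y z t : V) E := by
  set d := Metric.infDist (AffineMap.lineMap y z t : V) E
  have hM0 : 0 ≤ M := (norm_nonneg z).trans hM
  have hF : t * δ ≤ d := by
    have hquot : F.mkQ (AffineMap.lineMap y z t) = t • F.mkQ z := by
      rw [AffineMap.lineMap_apply_module, map_add, map_smul, map_smul, F.mkQ_apply y,
        (Submodule.Quotient.mk_eq_zero F).2 hyF, smul_zero, zero_add]
    calc t * δ ≤ t * Metric.infDist z F := mul_le_mul_of_nonneg_left hz ht.1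
      _ = Metric.infDist (AffineMap.lineMap y z t : V) F := by
        rw [infDist_eq_norm_mkQ, infDist_eq_norm_mkQ, hquot, norm_smul, Real.norm_of_nonneg ht.1]
      _ ≤ d := Metric.infDist_le_infDist_of_subset hEF E.nonempty
  have hE : (1 - t) * δ ≤ d + t * M := by
    have hquot : (1 - t) • E.mkQ y = E.mkQ (AffineMap.lineMap y z t) - t • E.mkQ z := by
      rw [AffineMap.lineMap_apply_module, map_add, map_smul, map_smul, add_sub_cancel_right]
    calc (1 - t) * δ ≤ (1 - t) * Metric.infDist y E :=
        mul_le_mul_of_nonneg_left hy (sub_nonneg.2 ht.2)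
      _ = ‖E.mkQ (AffineMap.lineMap y z t) - t • E.mkQ z‖ := by
        rw [infDist_eq_norm_mkQ, ← hquot, norm_smul, Real.norm_of_nonneg (sub_nonneg.2 ht.2)]
      _ ≤ d + t * M := by
        refine (norm_sub_le _ _).trans (add_le_add (infDist_eq_norm_mkQ E _).ge ?_)
        rw [norm_smul, Real.norm_of_nonneg ht.1]
        exact mul_le_mul_of_nonneg_left ((Submodule.Quotient.norm_mk_le E z).trans hM) ht.1
  rw [div_le_iff₀ (by positivity)]
  nlinarith

theorem sq_div_le_infDist_brokenLine (hδ : 0 < δ) (hM : ∀ n, ‖x n‖ ≤ M)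
    (hx : ∀ n, δ ≤ Metric.infDist (x n) (spanBelow x n)) {v : ℝ} (hv : 0 ≤ v) :
    δ ^ 2 / (2 * δ + M) ≤ Metric.infDist (brokenLine x v) (spanBelow x ⌊v⌋₊) :=
  sq_div_le_infDist_lineMap (spanBelow_mono x ⌊v⌋₊.le_succ) (mem_spanBelow (Nat.lt_succ_self _)) hδ
    (hx _) (hx _) (hM _) ⟨sub_nonneg.2 (Nat.floor_le hv), by linarith [Nat.lt_floor_add_one v]⟩

end Profile

section ContinuousSeminorm

variable {𝕜 X : Type*} [NontriviallyNormedField 𝕜] [AddCommGroup X] [Module 𝕜 X]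

variable (𝕜) in
theorem exists_continuous_seminorm_lt_subset [TopologicalSpace X] [IsTopologicalAddGroup X]
    [PolynormableSpace 𝕜 X] {U : Set X} (hU : U ∈ 𝓝 (0 : X)) :
    ∃ q : Seminorm 𝕜 X, Continuous q ∧ ∃ r > 0, {w | q w < r} ⊆ U := by
  have hq := PolynormableSpace.withSeminorms 𝕜 X
  obtain ⟨s, r, hr, hsub⟩ := (hq.mem_nhds_iff 0 U).1 hU
  exact ⟨s.sup Subtype.val, Seminorm.continuous_finsetSup fun i _ => hq.continuous_seminorm i, r,
    hr, Seminorm.ball_zero_eq (s.sup Subtype.val) ▸ hsub⟩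

theorem setOf_seminorm_lt_mem_nhds_zero [TopologicalSpace X] {q : Seminorm 𝕜 X} (hq : Continuous q)
    {r : ℝ} (hr : 0 < r) : {w | q w < r} ∈ 𝓝 (0 : X) :=
  (isOpen_lt hq continuous_const).mem_nhds (by simpa)

theorem exists_forall_seminorm_le_of_isVonNBounded [TopologicalSpace X] [PolynormableSpace 𝕜 X]
    {C : Set X} (hC : Bornology.IsVonNBounded 𝕜 C) {q : Seminorm 𝕜 X} (hq : Continuous q) :
    ∃ M, ∀ y ∈ C, q y ≤ M := by
  have hseminorms := PolynormableSpace.withSeminorms 𝕜 X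
  obtain ⟨M, -, hM⟩ := hseminorms.isVonNBounded_iff_seminorm_bounded.1 hC ⟨q, hq⟩
  exact ⟨M, fun y hy => (hM y hy).le⟩

variable (𝕜) in
theorem exists_seminorm_le_of_not_totallyBounded [UniformSpace X] [IsUniformAddGroup X]
    [PolynormableSpace 𝕜 X] {C : Set X} (hC : ¬ TotallyBounded C) :
    ∃ p : Seminorm 𝕜 X, Continuous p ∧ ∃ ε > 0, ∀ s : Set X, s.Finite →
      ∃ y ∈ C, ∀ z ∈ s, ε ≤ p (y - z) := by
  contrapose! hC
  refine totallyBounded_iff_subset_finite_iUnion_nhds_zero.2 fun U hU => ?_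
  obtain ⟨p, hp, ε, hε, hpU⟩ := exists_continuous_seminorm_lt_subset 𝕜 hU
  obtain ⟨s, hs, hcover⟩ := hC p hp ε hε
  refine ⟨s, hs, fun y hy => ?_⟩
  obtain ⟨z, hz, hyz⟩ := hcover y hy
  exact Set.mem_iUnion₂.2 ⟨z, hz, y - z, hpU hyz, add_sub_cancel z y⟩

theorem uniformContinuous_of_forall_seminorm_lt [UniformSpace X] [IsUniformAddGroup X]
    [PolynormableSpace 𝕜 X] {α : Type*} [UniformSpace α] {g : α → X}
    (hg : ∀ q : Seminorm 𝕜 X, Continuous q → ∀ r > 0,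
      ∀ᶠ w in uniformity α, q (g w.1 - g w.2) < r) : UniformContinuous g := by
  intro W hW
  rw [uniformity_eq_comap_nhds_zero_swapped] at hW
  obtain ⟨U, hU, hUW⟩ := hW
  obtain ⟨q, hq, r, hr, hqU⟩ := exists_continuous_seminorm_lt_subset 𝕜 hU
  exact (hg q hq r hr).mono fun w hw => hUW (hqU hw)

theorem eventually_uniformity_seminorm_lt [UniformSpace X] [IsUniformAddGroup X]
    {p : Seminorm 𝕜 X} (hp : Continuous p) {ε : ℝ} (hε : 0 < ε) :
    ∀ᶠ w in uniformity X, p (w.1 - w.2) < ε := by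
  rw [uniformity_eq_comap_nhds_zero_swapped]
  exact ⟨_, setOf_seminorm_lt_mem_nhds_zero hp hε, fun _ => id⟩

theorem not_hasApproxFixedPointNet_of_le_seminorm {X : Type u} [AddCommGroup X] [Module 𝕜 X]
    [TopologicalSpace X] {C : Set X} {f : C → C} {p : Seminorm 𝕜 X} (hp : Continuous p) {r : ℝ}
    (hr : 0 < r) (hf : ∀ y : C, r ≤ p (y - f y)) : ¬ HasApproxFixedPointNet f := by
  rw [hasApproxFixedPointNet_iff, mem_closure_iff_nhds]
  intro hnet
  obtain ⟨_, hlt, y, rfl⟩ := hnet _ (setOf_seminorm_lt_mem_nhds_zero hp hr)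
  exact (hf y).not_gt hlt

end ContinuousSeminorm

section Target

-- `X` carries no topology here, so that `p` can serve as its norm.
theorem exists_displacing_profiles {X : Type*} [AddCommGroup X] [Module ℝ X] (p : Seminorm ℝ X)
    {C : Set X} {M ε : ℝ} (hM : ∀ y ∈ C, p y ≤ M) (hε : 0 < ε)
    (hfin : ∀ s : Set X, s.Finite → ∃ y ∈ C, ∀ z ∈ s, ε ≤ p (y - z)) :
    ∃ (x : ℕ → X) (Φ : X → ℕ → ℝ) (c : ℝ), 0 < c ∧ (∀ n, x n ∈ C) ∧ (∀ y, IsProfile (Φ y)) ∧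
      (∀ y z n, |Φ y n - Φ z n| ≤ p (y - z) / c) ∧ ∀ y, c / 100 ≤ p (y - target x (Φ y)) := by
  let _ : SeminormedAddCommGroup X := p.toSeminormedAddCommGroup
  let _ : NormedSpace ℝ X := ⟨fun a x => (map_smul_eq_mul p a x).le⟩
  have hC : ¬ TotallyBounded C := fun htb => by
    obtain ⟨t, ht, hcover⟩ := Metric.totallyBounded_iff.1 htb ε hε
    obtain ⟨y, hy, hfar⟩ := hfin t ht
    obtain ⟨z, hz, hyz⟩ := Set.mem_iUnion₂.1 (hcover hy)
    exact (hfar z hz).not_gt ((dist_eq_norm y z).symm.trans_lt hyz)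
  obtain ⟨δ, hδ, x, hx⟩ :=
    exists_seq_le_infDist_spanBelow (isBounded_iff_forall_norm_le.2 ⟨M, hM⟩) hC
  have hM0 : 0 ≤ M := (apply_nonneg p _).trans (hM _ (hx 0).1)
  have hc : 0 < δ ^ 2 / (2 * δ + M) := by positivity
  exact ⟨x, profile x _, _, hc, fun n => (hx n).1, isProfile_profile x hc,
    abs_profile_sub_le x hc, div_hundred_le_norm_sub_target hc fun v hv =>
      sq_div_le_infDist_brokenLine hδ (fun n => hM _ (hx n).1) (fun n => (hx n).2) hv⟩

theorem uniformContinuous_target {X : Type*} [AddCommGroup X] [Module ℝ X]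
    [UniformSpace X] [IsUniformAddGroup X] [PolynormableSpace ℝ X] {C : Set X} (hC : Convex ℝ C)
    (hbdd : Bornology.IsVonNBounded ℝ C) {x : ℕ → X} (hx : ∀ n, x n ∈ C) {p : Seminorm ℝ X}
    (hp : Continuous p) {c : ℝ} (hc : 0 < c) {Φ : X → ℕ → ℝ} (hΦ : ∀ y, IsProfile (Φ y))
    (hΦp : ∀ y z n, |Φ y n - Φ z n| ≤ p (y - z) / c) :
    UniformContinuous fun y => target x (Φ y) := by
  refine uniformContinuous_of_forall_seminorm_lt (𝕜 := ℝ) fun q hq r hr => ?_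
  obtain ⟨N, hN⟩ := exists_forall_seminorm_le_of_isVonNBounded hbdd hq
  have hN0 : 0 ≤ N := (apply_nonneg q _).trans (hN _ (hx 0))
  have hD : ∀ y ∈ C, ∀ z ∈ C, q (y - z) ≤ 2 * N := fun y hy z hz =>
    (map_sub_le_add q y z).trans (by linarith [hN y hy, hN z hz])
  obtain ⟨η, hη, hη', hηr⟩ : ∃ η > 0, η ≤ 1 / 12 ∧ 115 * η * (2 * N) < r := by
    have hpos : 0 < min (1 / 12) (r / (230 * (N + 1))) := by positivity
    have hle := (le_div_iff₀ (by positivity)).1 (min_le_right (1 / 12) (r / (230 * (N + 1))))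
    exact ⟨_, hpos, min_le_left _ _, by linarith⟩
  filter_upwards [eventually_uniformity_seminorm_lt hp (mul_pos hη hc)] with ⟨y, z⟩ hyz
  have hprofile : ∀ n, |Φ y n - Φ z n| ≤ η := fun n =>
    (hΦp y z n).trans ((div_le_iff₀ hc).2 hyz.le)
  exact ((hΦ y).seminorm_target_sub_le q hC hx hD (hΦ z) hprofile hη').trans_lt hηr

end Target

theorem theorem2 {𝕜 : Type*} [RCLike 𝕜] {X : Type*} [AddCommGroup X] [Module 𝕜 X] [Module ℝ X]
    [IsScalarTower ℝ 𝕜 X] [UniformSpace X] [IsUniformAddGroup X] [ContinuousSMul 𝕜 X]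
    [LocallyConvexSpace ℝ X] (C : Set X) (hconv : Convex ℝ C)
    (hbdd : Bornology.IsVonNBounded 𝕜 C) (hntb : ¬ TotallyBounded C) :
    ∃ f : C → C, UniformContinuous f ∧ ¬ HasApproxFixedPointNet f := by
  have : ContinuousSMul ℝ X := IsScalarTower.continuousSMul 𝕜
  have hbddR : Bornology.IsVonNBounded ℝ C := hbdd.restrict_scalars ℝ
  obtain ⟨p, hp, ε, hε, hfin⟩ := exists_seminorm_le_of_not_totallyBounded ℝ hntb
  obtain ⟨M, hM⟩ := exists_forall_seminorm_le_of_isVonNBounded hbddR hp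
  obtain ⟨x, Φ, c, hc, hx, hΦ, hΦp, hdisp⟩ := exists_displacing_profiles p hM hε hfin
  exact ⟨fun y => ⟨target x (Φ y), target_mem hconv hx _⟩,
    ((uniformContinuous_target hconv hbddR hx hp hc hΦ hΦp).comp
      uniformContinuous_subtype_val).subtype_mk _,
    not_hasApproxFixedPointNet_of_le_seminorm hp (by positivity) fun y => hdisp y⟩
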